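/- Let $\mathcal H=\ell^2(\mathbb Z;\mathbb C^2)$ and write $\Psi(x)=(\Psi_L(x),\Psi_R(x))^{T}$ for $\Psi\in\mathcal H$. For $j\in\{m,o,p\}$ let $\alpha_j,\beta_j\in\mathbb C$ and $\Delta_j\in[0,2\pi)$ satisfy $\alpha_j\neq0$ and $|\alpha_j|^2+|\beta_j|^2=1$, and put $(\alpha_x,\beta_x,\Delta_x)=(\alpha_m,\beta_m,\Delta_m)$ for $x<0$, $(\alpha_o,\beta_o,\Delta_o)$ for $x=0$, and $(\alpha_p,\beta_p,\Delta_p)$ for $x>0$. Let $U=SC$ be the time evolution of the two-phase quantum walk with one defect, where $S$ and $C$ are the unitary operators on $\mathcal H$ given by $$(S\Psi)(x)=\begin{bmatrix}\Psi_L(x+1)\\ \Psi_R(x-1)\end{bmatrix},\qquad (C\Psi)(x)=e^{i\Delta_x}\begin{bmatrix}\alpha_x&\beta_x\\-\overline{\beta_x}&\overline{\alpha_x}\end{bmatrix}\Psi(x),$$ and let $\sigma_{\rm p}(U)$ be the set of eigenvalues of $U$. Assume $(\alpha_o,\beta_o,\Delta_o)=(\alpha_p,\beta_p,\Delta_p)$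 and $\Delta_p=\Delta_m=\Delta$. Then $\sigma_{\rm p}(U)\neq\emptyset$ if and only if $$\bigl(\Re(\beta_m\overline{\beta_p})-|\beta_p|^2\bigr)\bigl(\Re(\beta_m\overline{\beta_p})-|\beta_m|^2\bigr)>0.$$ In that case $\sigma_{\rm p}(U)=\{e^{i\lambda_1},-e^{i\lambda_1}\}$, where $$e^{i\lambda_1}=\frac{e^{i\Delta}\Bigl(\sqrt{\bigl(\Re(\beta_m\overline{\beta_p})+|\alpha_p||\alpha_m|-1\bigr)\bigl(\Re(\beta_m\overline{\beta_p})-|\alpha_p||\alpha_m|-1\bigr)}+i\,\Im(\beta_m\overline{\beta_p})\Bigr)}{|\beta_p-\beta_m|};$$ here the quantity under the square root is nonnegative and $\beta_p\neq\beta_m$. -/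

import Mathlib

open scoped ComplexConjugate

noncomputable section

namespace QuantumWalk

open scoped Matrix

/-- The Hilbert space of states `ℓ²(ℤ; ℂ²)`. For a state `Ψ`, the coordinate `Ψ x 0` is the left
component `Ψ_L(x)` and `Ψ x 1` is the right component `Ψ_R(x)`. -/
abbrev State : Type := lp (fun _ : ℤ => EuclideanSpace ℂ (Fin 2)) 2

/-- The parameters `(α, β, Δ)` of a coin matrix: `α, β ∈ ℂ` with `α ≠ 0` and
`|α|² + |β|² = 1`, and `Δ ∈ [0, 2π)`. -/
@[ext]
structure Coin where
  α : ℂ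
  β : ℂ
  Δ : ℝ
  α_ne_zero : α ≠ 0
  sq_add_sq : ‖α‖ ^ 2 + ‖β‖ ^ 2 = 1
  Δ_mem : Δ ∈ Set.Ico 0 (2 * Real.pi)

/-- The coin matrix `e^{iΔ} [[α, β], [-conj β, conj α]]`. -/
def Coin.matrix (c : Coin) : Matrix (Fin 2) (Fin 2) ℂ :=
  Complex.exp (Complex.I * c.Δ) • !![c.α, c.β; -conj c.β, conj c.α]

theorem Coin.matrix_mem_unitaryGroup (c : Coin) :
    c.matrix ∈ Matrix.unitaryGroup (Fin 2) ℂ := by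
  have h : c.α * conj c.α + c.β * conj c.β = 1 := by
    rw [Complex.mul_conj', Complex.mul_conj']
    exact_mod_cast c.sq_add_sq
  have he : Complex.exp (Complex.I * c.Δ) * conj (Complex.exp (Complex.I * c.Δ)) = 1 := by
    rw [Complex.mul_conj', mul_comm, Complex.norm_exp_ofReal_mul_I]
    simp
  rw [Matrix.mem_unitaryGroup_iff]
  ext i j
  fin_cases i <;> fin_cases j <;>
    simp [Coin.matrix, Matrix.mul_apply, Matrix.star_apply, Fin.sum_univ_two]
  · linear_combination
      (Complex.exp (Complex.I * c.Δ) * conj (Complex.exp (Complex.I * c.Δ))) * h + he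
  · ring
  · ring
  · linear_combination
      (Complex.exp (Complex.I * c.Δ) * conj (Complex.exp (Complex.I * c.Δ))) * h + he

/-- The coin matrix as an element of the unitary group. -/
def Coin.unitary (c : Coin) : Matrix.unitaryGroup (Fin 2) ℂ :=
  ⟨c.matrix, c.matrix_mem_unitaryGroup⟩

theorem norm_unitary_mulVec (M : Matrix.unitaryGroup (Fin 2) ℂ) (v : EuclideanSpace ℂ (Fin 2)) :
    ‖(WithLp.toLp 2 (M.1 *ᵥ v.ofLp) : EuclideanSpace ℂ (Fin 2))‖ = ‖v‖ := by
  have h : M.1ᴴ * M.1 = 1 := Matrix.mem_unitaryGroup_iff'.1 M.2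
  have h2 : inner ℂ (WithLp.toLp 2 (M.1 *ᵥ v.ofLp) : EuclideanSpace ℂ (Fin 2))
      (WithLp.toLp 2 (M.1 *ᵥ v.ofLp)) = inner ℂ v v := by
    rw [EuclideanSpace.inner_eq_star_dotProduct, EuclideanSpace.inner_eq_star_dotProduct,
      Matrix.star_mulVec, dotProduct_comm, ← Matrix.dotProduct_mulVec, Matrix.mulVec_mulVec, h,
      Matrix.one_mulVec, dotProduct_comm]
  rw [inner_self_eq_norm_sq_to_K, inner_self_eq_norm_sq_to_K] at h2
  have h3 : ‖(WithLp.toLp 2 (M.1 *ᵥ v.ofLp) : EuclideanSpace ℂ (Fin 2))‖ ^ 2 = ‖v‖ ^ 2 := by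
    exact_mod_cast h2
  exact (sq_eq_sq₀ (norm_nonneg _) (norm_nonneg _)).1 h3

theorem summable_norm_sq (Ψ : State) : Summable fun x : ℤ => ‖Ψ x‖ ^ 2 := by
  have h := (lp.memℓp Ψ).summable (by norm_num)
  simpa using h

theorem norm_sq_eq (Ψ : State) : ‖Ψ‖ ^ 2 = ∑' x : ℤ, ‖Ψ x‖ ^ 2 := by
  have h := lp.norm_rpow_eq_tsum (p := 2) (by norm_num) Ψ
  simpa using h

theorem memℓp_of_summable {f : ℤ → EuclideanSpace ℂ (Fin 2)}
    (hf : Summable fun x : ℤ => ‖f x‖ ^ 2) : Memℓp f 2 :=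
  memℓp_gen (by simpa using hf)

/-- The linear map `(CΨ)(x) = M_x Ψ(x)` for a family of unitary `2 × 2` matrices `M_x`. -/
def coinLin (M : ℤ → Matrix.unitaryGroup (Fin 2) ℂ) : State →ₗ[ℂ] State where
  toFun Ψ := ⟨fun x => WithLp.toLp 2 ((M x).1 *ᵥ (Ψ x).ofLp),
    memℓp_of_summable (by simpa only [norm_unitary_mulVec] using summable_norm_sq Ψ)⟩
  map_add' Ψ Φ := by
    refine lp.ext (funext fun x => ?_)
    change WithLp.toLp 2 ((M x).1 *ᵥ ((Ψ x).ofLp + (Φ x).ofLp)) =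
      WithLp.toLp 2 ((M x).1 *ᵥ (Ψ x).ofLp) + WithLp.toLp 2 ((M x).1 *ᵥ (Φ x).ofLp)
    rw [Matrix.mulVec_add, WithLp.toLp_add]
  map_smul' a Ψ := by
    refine lp.ext (funext fun x => ?_)
    change WithLp.toLp 2 ((M x).1 *ᵥ (a • (Ψ x).ofLp)) =
      a • WithLp.toLp 2 ((M x).1 *ᵥ (Ψ x).ofLp)
    rw [Matrix.mulVec_smul, WithLp.toLp_smul]

theorem coinLin_apply (M : ℤ → Matrix.unitaryGroup (Fin 2) ℂ) (Ψ : State) (x : ℤ) :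
    coinLin M Ψ x = WithLp.toLp 2 ((M x).1 *ᵥ (Ψ x).ofLp) := rfl

theorem coinLin_comp (M N : ℤ → Matrix.unitaryGroup (Fin 2) ℂ) (h : ∀ x, M x * N x = 1) :
    coinLin M ∘ₗ coinLin N = LinearMap.id := by
  refine LinearMap.ext fun Ψ => lp.ext (funext fun x => ?_)
  have hx : (M x).1 * (N x).1 = 1 := congrArg Subtype.val (h x)
  change WithLp.toLp 2 ((M x).1 *ᵥ ((N x).1 *ᵥ (Ψ x).ofLp)) = Ψ x
  rw [Matrix.mulVec_mulVec, hx, Matrix.one_mulVec]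

/-- The coin operator `(CΨ)(x) = C_x Ψ(x)`, a unitary operator on the state space. -/
def coinOp (c : ℤ → Coin) : State ≃ₗᵢ[ℂ] State where
  toLinearEquiv := LinearEquiv.ofLinearMap (coinLin fun x => (c x).unitary)
    (coinLin fun x => ((c x).unitary)⁻¹)
    (coinLin_comp _ _ fun _ => mul_inv_cancel _) (coinLin_comp _ _ fun _ => inv_mul_cancel _)
  norm_map' Ψ := by
    refine (sq_eq_sq₀ (norm_nonneg _) (norm_nonneg _)).1 ?_
    rw [norm_sq_eq, norm_sq_eq]
    refine tsum_congr fun x => ?_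
    rw [LinearEquiv.coe_ofLinearMap, coinLin_apply, norm_unitary_mulVec]

theorem summable_coord (Ψ : State) (i : Fin 2) : Summable fun x : ℤ => ‖Ψ x i‖ ^ 2 := by
  refine (summable_norm_sq Ψ).of_nonneg_of_le (fun _ => by positivity) fun x => ?_
  have := PiLp.norm_apply_le (Ψ x) i
  gcongr

theorem summable_shift (Ψ : State) (k : ℤ) (i : Fin 2) :
    Summable fun x : ℤ => ‖Ψ (x + k) i‖ ^ 2 :=
  (Equiv.addRight k).summable_iff.2 (summable_coord Ψ i)

/-- The linear map sending `Ψ` to `x ↦ (Ψ_L(x + k), Ψ_R(x - k))`. -/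
def shiftLin (k : ℤ) : State →ₗ[ℂ] State where
  toFun Ψ := ⟨fun x => !₂[Ψ (x + k) 0, Ψ (x - k) 1], memℓp_of_summable (by
    simpa [EuclideanSpace.norm_sq_eq, Fin.sum_univ_two, sub_eq_add_neg] using
      (summable_shift Ψ k 0).add (summable_shift Ψ (-k) 1))⟩
  map_add' Ψ Φ := by
    refine lp.ext (funext fun x => PiLp.ext fun i => ?_)
    fin_cases i <;> rfl
  map_smul' a Ψ := by
    refine lp.ext (funext fun x => PiLp.ext fun i => ?_)
    fin_cases i <;> rfl

theorem shiftLin_apply (k : ℤ) (Ψ : State) (x : ℤ) :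
    shiftLin k Ψ x = !₂[Ψ (x + k) 0, Ψ (x - k) 1] := rfl

theorem shiftLin_comp (k l : ℤ) (h : k + l = 0) :
    shiftLin k ∘ₗ shiftLin l = LinearMap.id := by
  obtain rfl : l = -k := by lia
  ext Ψ x i
  fin_cases i <;> simp [shiftLin_apply]

/-- The shift operator `(SΨ)(x) = (Ψ_L(x + 1), Ψ_R(x - 1))`, a unitary operator on the
state space. -/
def shiftOp : State ≃ₗᵢ[ℂ] State where
  toLinearEquiv := LinearEquiv.ofLinearMap (shiftLin 1) (shiftLin (-1))
    (shiftLin_comp _ _ (by norm_num)) (shiftLin_comp _ _ (by norm_num))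
  norm_map' Ψ := by
    refine (sq_eq_sq₀ (norm_nonneg _) (norm_nonneg _)).1 ?_
    rw [norm_sq_eq, norm_sq_eq, LinearEquiv.coe_ofLinearMap]
    have h1 : ∀ x, ‖shiftLin 1 Ψ x‖ ^ 2 = ‖Ψ (x + 1) 0‖ ^ 2 + ‖Ψ (x + -1) 1‖ ^ 2 := fun x => by
      rw [shiftLin_apply, EuclideanSpace.norm_sq_eq, Fin.sum_univ_two]
      rfl
    have h2 : ∀ x, ‖Ψ x‖ ^ 2 = ‖Ψ x 0‖ ^ 2 + ‖Ψ x 1‖ ^ 2 := fun x => by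
      rw [EuclideanSpace.norm_sq_eq, Fin.sum_univ_two]
    rw [tsum_congr h1, tsum_congr h2, (summable_coord Ψ 0).tsum_add (summable_coord Ψ 1),
      (summable_shift Ψ 1 0).tsum_add (summable_shift Ψ (-1) 1)]
    exact congrArg₂ (· + ·) ((Equiv.addRight (1 : ℤ)).tsum_eq fun x => ‖Ψ x 0‖ ^ 2)
      ((Equiv.addRight (-1 : ℤ)).tsum_eq fun x => ‖Ψ x 1‖ ^ 2)

/-- The time evolution `U = SC` of the quantum walk with coins `c x`, `x ∈ ℤ`. -/
def evolution (c : ℤ → Coin) : State ≃ₗᵢ[ℂ] State :=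
  (coinOp c).trans shiftOp

/-- The coins of the two-phase quantum walk with one defect: `cm` at `x < 0`, `co` at `x = 0`,
`cp` at `x > 0`. -/
def twoPhaseOneDefect (cm co cp : Coin) (x : ℤ) : Coin :=
  if x < 0 then cm else if x = 0 then co else cp

/-- The point spectrum of `U`: the set of its eigenvalues, i.e. of all `μ ∈ ℂ` for which there is
a nonzero state `Ψ` with `U Ψ = μ Ψ`. -/
def pointSpectrum (U : State ≃ₗᵢ[ℂ] State) : Set ℂ :=
  {μ : ℂ | ∃ Ψ : State, Ψ ≠ 0 ∧ U Ψ = μ • Ψ}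

end QuantumWalk

end

open scoped ComplexConjugate
open Filter Topology

namespace QuantumWalk

/-! Write an eigenvalue as `e^{iΔ} z` with `|z| = 1`. In the vectors `v x = (Ψ_L (x-1), Ψ_R x)` the
eigenvalue equation is a transfer recursion whose matrix preserves the indefinite form `|a|² -
|b|²`. A solution decaying at an end is therefore isotropic, spanned by `(1, u)` with `|u| = 1`, and
is an eigenvector there (`exists_contracting_of_tendsto_zero`). Square-summability at both ends
forces the same `u` to serve both coins, which is `IsMatching`; conversely a matching pair yields a
two-sided geometric eigenvector.

Matching means that `βp * u` and `βm * u` have the same imaginary part `Im z` and lie strictly on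
opposite sides of the imaginary axis. Hence `u = ± conj (βp - βm) / |βp - βm|`;
`product_eq_of_im_eq` turns the opposite signs into the stated inequality, and
`IsMatching.mul_norm_eq` computes `z` up to sign. -/

theorem eq_of_antitone_const {f : ℕ → ℂ} {l : ℂ} (hf : ∀ n, f (n + 1) = f n)
    (h : Tendsto f atTop (𝓝 l)) : f 0 = l := by
  have hc : f = fun _ => f 0 := by
    funext n
    induction n with
    | zero => rfl
    | succ k ih => rw [hf, ih]
  rw [hc] at h
  exact tendsto_nhds_unique tendsto_const_nhds h

/-- A decaying solution of the recursion with transfer matrix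
`α⁻¹ [[z, -β], [-conj β, conj z]]` starts at an isotropic contracting eigenvector `(1, u)`. -/
theorem exists_contracting_of_tendsto_zero {α β z : ℂ} (hα : α ≠ 0)
    (hαβ : α * conj α + β * conj β = 1) (hz : z * conj z = 1) {a b : ℕ → ℂ}
    (ha : ∀ n, α * a (n + 1) = z * a n - β * b n)
    (hb : ∀ n, α * b (n + 1) = -conj β * a n + conj z * b n)
    (ha0 : Tendsto a atTop (𝓝 0)) (hb0 : Tendsto b atTop (𝓝 0)) (h0 : a 0 ≠ 0 ∨ b 0 ≠ 0) :
    a 0 ≠ 0 ∧ b 0 / a 0 * conj (b 0 / a 0) = 1 ∧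
      conj z - conj β * conj (b 0 / a 0) = z - β * (b 0 / a 0) ∧
      ‖z - β * (b 0 / a 0)‖ < ‖α‖ := by
  have hα' : conj α ≠ 0 := (map_ne_zero _).2 hα
  have hac : ∀ n, conj α * conj (a (n + 1)) = conj z * conj (a n) - conj β * conj (b n) :=
    fun n => by simpa using congrArg conj (ha n)
  have hbc : ∀ n, conj α * conj (b (n + 1)) = -β * conj (a n) + z * conj (b n) :=
    fun n => by simpa using congrArg conj (hb n)
  have hca : Tendsto (fun n => conj (a n)) atTop (𝓝 0) := by
    simpa [Function.comp_def] using (Complex.continuous_conj.tendsto 0).comp ha0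
  have hcb : Tendsto (fun n => conj (b n)) atTop (𝓝 0) := by
    simpa [Function.comp_def] using (Complex.continuous_conj.tendsto 0).comp hb0
  -- The transfer matrix preserves the sesquilinear form of signature (1,1).
  have form : ∀ k m, a (k + 1) * conj (a (m + 1)) - b (k + 1) * conj (b (m + 1)) =
      a k * conj (a m) - b k * conj (b m) := fun k m => by
    refine mul_left_cancel₀ (mul_ne_zero hα hα') ?_
    calc α * conj α * (a (k + 1) * conj (a (m + 1)) - b (k + 1) * conj (b (m + 1)))
        = (α * a (k + 1)) * (conj α * conj (a (m + 1))) -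
          (α * b (k + 1)) * (conj α * conj (b (m + 1))) := by ring
      _ = α * conj α * (a k * conj (a m) - b k * conj (b m)) := by
        rw [ha, hb, hac, hbc]
        linear_combination (a k * conj (a m) - b k * conj (b m)) * (hz - hαβ)
  have q0 : a 0 * conj (a 0) - b 0 * conj (b 0) = 0 :=
    eq_of_antitone_const (f := fun n => a n * conj (a n) - b n * conj (b n))
      (fun n => form n n) (by simpa using (ha0.mul hca).sub (hb0.mul hcb))
  -- Consecutive vectors are also orthogonal. An isotropic line in signature (1,1) is its own
  -- orthogonal complement, so step 1 is parallel to step 0.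
  have f0 : a 0 * conj (a 1) - b 0 * conj (b 1) = 0 :=
    eq_of_antitone_const (f := fun n => a n * conj (a (n + 1)) - b n * conj (b (n + 1)))
      (fun n => form n (n + 1)) (by
        simpa using (ha0.mul ((tendsto_add_atTop_iff_nat 1).2 hca)).sub
          (hb0.mul ((tendsto_add_atTop_iff_nat 1).2 hcb)))
  have hne : a 0 ≠ 0 := fun h => by
    rw [h] at q0
    simp_all
  have hne' : conj (a 0) ≠ 0 := (map_ne_zero _).2 hne
  obtain ⟨u, hu⟩ : ∃ u, u = b 0 / a 0 := ⟨_, rfl⟩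
  have hbu : b 0 = u * a 0 := by rw [hu, div_mul_cancel₀ _ hne]
  have hbuc : conj (b 0) = conj u * conj (a 0) := by rw [hbu, map_mul]
  rw [← hu]
  have hu1 : u * conj u = 1 := by
    refine mul_left_cancel₀ (mul_ne_zero hne hne') ?_
    rw [hbuc, hbu] at q0
    linear_combination -q0
  have him : conj z - conj β * conj u = z - β * u := by
    refine mul_left_cancel₀ (mul_ne_zero hne hne') ?_
    have h1 := hac 0
    have h2 := hbc 0
    rw [zero_add] at h1 h2
    rw [hbuc] at h1 h2
    rw [hbu] at f0
    linear_combination conj α * f0 - a 0 * h1 + u * a 0 * h2 + a 0 * conj (a 0) * z * hu1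
  refine ⟨hne, hu1, him, ?_⟩
  -- `him` and `hu1` make `(1, u)` an eigenvector, so the solution is geometric and decay bounds its
  -- ratio.
  have hab : ∀ n, b n = u * a n ∧ a n = ((z - β * u) / α) ^ n * a 0 := fun n => by
    induction n with
    | zero => exact ⟨hbu, by simp⟩
    | succ n ih =>
      have h1 : a (n + 1) = ((z - β * u) / α) * a n := by
        rw [div_mul_eq_mul_div, eq_div_iff hα]
        linear_combination ha n - β * ih.1
      refine ⟨mul_left_cancel₀ hα ?_, by rw [h1, ih.2, pow_succ']; ring⟩
      have h2 := ha n
      have h3 := hb n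
      rw [ih.1] at h2 h3
      linear_combination h3 - u * h2 + a n * (u * him + conj β * hu1)
  have hlim : Tendsto (fun n => ‖(z - β * u) / α‖ ^ n) atTop (𝓝 0) := by
    have h := (ha0.div_const (a 0)).norm
    simp only [zero_div, norm_zero] at h
    refine h.congr fun n => ?_
    rw [(hab n).2, mul_div_cancel_right₀ _ hne, norm_pow]
  have hlt : ‖(z - β * u) / α‖ < 1 := by
    simpa only [abs_norm] using tendsto_pow_atTop_nhds_zero_iff.1 hlim
  rwa [norm_div, div_lt_one (norm_pos_iff.2 hα)] at hlt

/-! ### The eigenvalue equation as a transfer recursion -/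

theorem Coin.mul_conj_add (c : Coin) : c.α * conj c.α + c.β * conj c.β = 1 := by
  rw [Complex.mul_conj', Complex.mul_conj']
  exact_mod_cast c.sq_add_sq

theorem evolution_apply_zero (c : ℤ → Coin) (Ψ : State) (x : ℤ) :
    evolution c Ψ x 0 = Complex.exp (Complex.I * (c (x + 1)).Δ) *
      ((c (x + 1)).α * Ψ (x + 1) 0 + (c (x + 1)).β * Ψ (x + 1) 1) := by
  change (WithLp.toLp 2 (Matrix.mulVec (c (x + 1)).matrix (Ψ (x + 1)).ofLp) : EuclideanSpace ℂ (Fin 2)) 0 = _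
  simp [Coin.matrix, Matrix.mulVec, dotProduct, Fin.sum_univ_two]
  ring

theorem evolution_apply_one (c : ℤ → Coin) (Ψ : State) (x : ℤ) :
    evolution c Ψ x 1 = Complex.exp (Complex.I * (c (x - 1)).Δ) *
      (-conj (c (x - 1)).β * Ψ (x - 1) 0 + conj (c (x - 1)).α * Ψ (x - 1) 1) := by
  change (WithLp.toLp 2 (Matrix.mulVec (c (x - 1)).matrix (Ψ (x - 1)).ofLp) : EuclideanSpace ℂ (Fin 2)) 1 = _
  simp [Coin.matrix, Matrix.mulVec, dotProduct, Fin.sum_univ_two]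
  ring

theorem tendsto_coord_cofinite (Ψ : State) (i : Fin 2) :
    Tendsto (fun x : ℤ => Ψ x i) cofinite (𝓝 0) := by
  have h := (summable_coord Ψ i).tendsto_cofinite_zero
  rw [tendsto_zero_iff_norm_tendsto_zero]
  simpa [Real.sqrt_sq] using h.sqrt

theorem norm_eq_one_of_mem_pointSpectrum {U : State ≃ₗᵢ[ℂ] State} {μ : ℂ}
    (h : μ ∈ pointSpectrum U) : ‖μ‖ = 1 := by
  obtain ⟨Ψ, hΨ, he⟩ := h
  have h1 := congrArg norm he
  rw [U.norm_map, norm_smul] at h1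
  exact (mul_right_cancel₀ (norm_ne_zero_iff.2 hΨ) ((one_mul _).trans h1)).symm

/-- The pairs `(z, u)` for which `(1, u)` spans both the contracting eigenspace on the right
and the expanding eigenspace on the left, at the quasi-energy `z`. -/
structure IsMatching (βm βp z u : ℂ) : Prop where
  norm_z : ‖z‖ = 1
  norm_u : ‖u‖ = 1
  im_right : (βp * u).im = z.im
  im_left : (βm * u).im = z.im
  re_right : 0 < z.re * (βp * u).re
  re_left : z.re * (βm * u).re < 0

theorem IsMatching.neg {βm βp z u : ℂ} (h : IsMatching βm βp z u) :
    IsMatching βm βp (-z) (-u) := by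
  obtain ⟨h1, h2, h3, h4, h5, h6⟩ := h
  constructor <;> simpa only [norm_neg, mul_neg, Complex.neg_re, Complex.neg_im, neg_inj, neg_mul,
    neg_neg]

theorem sq_re_add_sq_im (w : ℂ) : w.re ^ 2 + w.im ^ 2 = ‖w‖ ^ 2 := by
  rw [Complex.sq_norm, Complex.normSq_apply]
  ring

/-- The defect-free two-phase coin sequence satisfies the transfer recursion. -/
theorem eigen_recursion {c : ℤ → Coin} {Δ : ℝ} (hΔ : ∀ x, (c x).Δ = Δ) {Ψ : State} {z : ℂ}
    (hz : z * conj z = 1)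
    (h : evolution c Ψ = (Complex.exp (Complex.I * Δ) * z) • Ψ) (x : ℤ) :
    (c x).α * Ψ x 0 = z * Ψ (x - 1) 0 - (c x).β * Ψ x 1 ∧
      (c x).α * Ψ (x + 1) 1 = -conj (c x).β * Ψ (x - 1) 0 + conj z * Ψ x 1 := by
  have he := Complex.exp_ne_zero (Complex.I * Δ)
  have h0 := evolution_apply_zero c Ψ (x - 1)
  have h1 := evolution_apply_one c Ψ (x + 1)
  rw [h, hΔ, sub_add_cancel] at h0
  rw [h, hΔ, add_sub_cancel_right] at h1
  have h0' : z * Ψ (x - 1) 0 = (c x).α * Ψ x 0 + (c x).β * Ψ x 1 := by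
    refine mul_left_cancel₀ he ?_
    rw [← h0]
    simp [mul_assoc]
  have h1' : z * Ψ (x + 1) 1 = -conj (c x).β * Ψ x 0 + conj (c x).α * Ψ x 1 := by
    refine mul_left_cancel₀ he ?_
    rw [← h1]
    simp [mul_assoc]
  have hc := (c x).mul_conj_add
  refine ⟨by linear_combination -h0', ?_⟩
  linear_combination (-(c x).α * Ψ (x + 1) 1 - conj (c x).β * Ψ (x - 1) 0) * hz
    + conj z * (c x).α * h1' + conj z * conj (c x).β * h0' + conj z * Ψ x 1 * hc

/-- The inverse of the transfer recursion. -/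
theorem eigen_recursion_symm {c : ℤ → Coin} {Δ : ℝ} (hΔ : ∀ x, (c x).Δ = Δ) {Ψ : State} {z : ℂ}
    (hz : z * conj z = 1)
    (h : evolution c Ψ = (Complex.exp (Complex.I * Δ) * z) • Ψ) (x : ℤ) :
    conj (c x).α * Ψ (x - 1) 0 = conj z * Ψ x 0 + (c x).β * Ψ (x + 1) 1 ∧
      conj (c x).α * Ψ x 1 = conj (c x).β * Ψ x 0 + z * Ψ (x + 1) 1 := by
  obtain ⟨h0, h1⟩ := eigen_recursion hΔ hz h x
  have hc := (c x).mul_conj_add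
  constructor
  · refine mul_left_cancel₀ (c x).α_ne_zero ?_
    linear_combination -conj z * h0 - (c x).β * h1 + Ψ (x - 1) 0 * (hc - hz)
  · refine mul_left_cancel₀ (c x).α_ne_zero ?_
    linear_combination -conj (c x).β * h0 - z * h1 + Ψ x 1 * (hc - hz)

/-- The recursion runs both ways, so one transfer vector determines the whole state. -/
theorem eq_zero_of_eigen {c : ℤ → Coin} {Δ : ℝ} (hΔ : ∀ x, (c x).Δ = Δ) {Ψ : State} {z : ℂ}
    (hz : z * conj z = 1)
    (h : evolution c Ψ = (Complex.exp (Complex.I * Δ) * z) • Ψ)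
    (h0 : Ψ (-1) 0 = 0) (h1 : Ψ 0 1 = 0) : Ψ = 0 := by
  have key : ∀ x : ℤ, Ψ (x - 1) 0 = 0 ∧ Ψ x 1 = 0 := fun x => by
    induction x using Int.induction_on with
    | zero => exact ⟨by simpa using h0, h1⟩
    | succ n ih =>
      have hr := eigen_recursion hΔ hz h n
      rw [ih.1, ih.2] at hr
      rw [add_sub_cancel_right]
      simpa [(c n).α_ne_zero] using hr
    | pred n ih =>
      have hr := eigen_recursion_symm hΔ hz h (-n - 1)
      rw [sub_add_cancel, ih.1, ih.2] at hr
      simpa [(c (-n - 1)).α_ne_zero] using hr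
  refine lp.ext (funext fun x => PiLp.ext fun i => ?_)
  fin_cases i
  · simpa using (key (x + 1)).1
  · exact (key x).2

/-! ### From an eigenvalue to a matching pair -/

theorem mul_conj_eq_one {z : ℂ} (h : ‖z‖ = 1) : z * conj z = 1 := by
  rw [Complex.mul_conj', h]
  simp

theorem norm_eq_one_of_mul_conj {z : ℂ} (h : z * conj z = 1) : ‖z‖ = 1 := by
  rw [Complex.mul_conj'] at h
  have h' : ‖z‖ ^ 2 = 1 := by exact_mod_cast h
  exact (pow_eq_one_iff_of_nonneg (norm_nonneg z) two_ne_zero).1 h'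

theorem sub_conj_eq_iff {w z : ℂ} : conj z - conj w = z - w ↔ w.im = z.im := by
  rw [← map_sub, Complex.conj_eq_iff_im, Complex.sub_im, sub_eq_zero, eq_comm]

/-- A real eigenvalue `(z - βu) / α` is contracting iff `Re z` and `Re (βu)` have the same sign. -/
theorem norm_sub_lt_iff {α β z u : ℂ} (hα : α ≠ 0) (hαβ : ‖α‖ ^ 2 + ‖β‖ ^ 2 = 1) (hz : ‖z‖ = 1)
    (hu : ‖u‖ = 1) (him : (β * u).im = z.im) :
    ‖z - β * u‖ < ‖α‖ ↔ 0 < z.re * (β * u).re := by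
  have hn : ‖z - β * u‖ ^ 2 = (z.re - (β * u).re) ^ 2 := by
    rw [← sq_re_add_sq_im, Complex.sub_re, Complex.sub_im, him]
    ring
  have h1 := sq_re_add_sq_im z
  have h2 := sq_re_add_sq_im (β * u)
  rw [norm_mul, hu, mul_one, him] at h2
  rw [hz] at h1
  have hpos : 0 < ‖α‖ ^ 2 := by positivity
  -- With `c = Re z` and `p = Re (βu)`, the hypotheses give `|α|² = c² - p² > 0`, so the claim is
  -- `(c - p)² < c² - p²`, i.e. `p² < c * p`.
  rw [← sq_lt_sq₀ (norm_nonneg _) (norm_nonneg _), hn]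
  generalize (β * u).re = p at *
  generalize z.re = c at *
  constructor
  · intro h
    nlinarith [sq_nonneg p]
  · intro h
    have hlt : p ^ 2 < c * p := by
      refine lt_of_pow_lt_pow_left₀ 2 h.le ?_
      have hp : 0 < p ^ 2 := by
        have : p ≠ 0 := fun h0 => by simp [h0] at h
        positivity
      nlinarith
    nlinarith

theorem twoPhaseOneDefect_of_neg {cm co cp : Coin} {x : ℤ} (hx : x < 0) :
    twoPhaseOneDefect cm co cp x = cm := if_pos hx

theorem twoPhaseOneDefect_of_nonneg {cm cp : Coin} {x : ℤ} (hx : 0 ≤ x) :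
    twoPhaseOneDefect cm cp cp x = cp := by
  rw [twoPhaseOneDefect, if_neg hx.not_gt, ite_self]

theorem twoPhaseOneDefect_Δ {cm cp : Coin} {Δ : ℝ} (hp : cp.Δ = Δ) (hm : cm.Δ = Δ) (x : ℤ) :
    (twoPhaseOneDefect cm cp cp x).Δ = Δ := by
  rcases lt_or_ge x 0 with hx | hx
  · rwa [twoPhaseOneDefect_of_neg hx]
  · rwa [twoPhaseOneDefect_of_nonneg hx]

theorem exists_isMatching {cm cp : Coin} {Δ : ℝ} (hp : cp.Δ = Δ) (hm : cm.Δ = Δ) {μ : ℂ}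
    (hμ : μ ∈ pointSpectrum (evolution (twoPhaseOneDefect cm cp cp))) :
    ∃ z u, μ = Complex.exp (Complex.I * Δ) * z ∧ IsMatching cm.β cp.β z u := by
  obtain ⟨z, rfl⟩ : ∃ z, μ = Complex.exp (Complex.I * Δ) * z :=
    ⟨μ / Complex.exp (Complex.I * Δ), (mul_div_cancel₀ _ (Complex.exp_ne_zero _)).symm⟩
  have hz := norm_eq_one_of_mem_pointSpectrum hμ
  rw [norm_mul, mul_comm Complex.I, Complex.norm_exp_ofReal_mul_I, one_mul] at hz
  have hzz := mul_conj_eq_one hz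
  obtain ⟨Ψ, hΨ, he⟩ := hμ
  have hΔ := twoPhaseOneDefect_Δ hp hm
  have hne : Ψ (-1) 0 ≠ 0 ∨ Ψ 0 1 ≠ 0 := by
    by_contra! hcon
    exact hΨ (eq_zero_of_eigen hΔ hzz he hcon.1 hcon.2)
  have lim : ∀ (i : Fin 2) (f : ℕ → ℤ), f.Injective →
      Tendsto (fun n => Ψ (f n) i) atTop (𝓝 0) := fun i f hf => by
    rw [← Nat.cofinite_eq_atTop]
    exact (tendsto_coord_cofinite Ψ i).comp hf.tendsto_cofinite
  have right := exists_contracting_of_tendsto_zero (a := fun n : ℕ => Ψ ((n : ℤ) - 1) 0)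
    (b := fun n : ℕ => Ψ n 1) cp.α_ne_zero cp.mul_conj_add hzz
    (fun n => by
      have h := (eigen_recursion hΔ hzz he n).1
      rw [twoPhaseOneDefect_of_nonneg (Int.natCast_nonneg n)] at h
      rw [Nat.cast_succ, add_sub_cancel_right]
      exact h)
    (fun n => by
      have h := (eigen_recursion hΔ hzz he n).2
      rw [twoPhaseOneDefect_of_nonneg (Int.natCast_nonneg n)] at h
      rw [Nat.cast_succ]
      exact h)
    (lim 0 _ fun _ _ h => by simpa using h) (lim 1 _ fun _ _ h => by simpa using h)
    (by simpa using hne)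
  -- The inverse transfer matrix has the same shape, with `α`, `β`, `z` replaced by `conj α`, `-β`,
  -- `conj z`.
  have left := exists_contracting_of_tendsto_zero (α := conj cm.α) (β := -cm.β) (z := conj z)
    (a := fun n : ℕ => Ψ (-(n : ℤ) - 1) 0)
    (b := fun n : ℕ => Ψ (-(n : ℤ)) 1) ((map_ne_zero _).2 cm.α_ne_zero)
    (by rw [Complex.conj_conj, map_neg, ← cm.mul_conj_add]; ring)
    (by rw [Complex.conj_conj, mul_comm, hzz])
    (fun n => by
      have h := (eigen_recursion_symm hΔ hzz he (-(n : ℤ) - 1)).1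
      rw [twoPhaseOneDefect_of_neg (by lia), sub_add_cancel] at h
      rw [Nat.cast_succ, neg_add, ← sub_eq_add_neg, h]
      ring)
    (fun n => by
      have h := (eigen_recursion_symm hΔ hzz he (-(n : ℤ) - 1)).2
      rw [twoPhaseOneDefect_of_neg (by lia), sub_add_cancel] at h
      rw [Nat.cast_succ, neg_add, ← sub_eq_add_neg, h, map_neg, Complex.conj_conj]
      ring)
    (lim 0 _ fun _ _ h => by simpa using h) (lim 1 _ fun _ _ h => by simpa using h)
    (by simpa using hne)
  simp only [Nat.cast_zero, neg_zero, zero_sub] at left right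
  -- Both half-lines start from the same vector, hence share `u`.
  generalize Ψ 0 1 / Ψ (-1) 0 = u at left right
  obtain ⟨-, hu, hr, hr'⟩ := right
  obtain ⟨-, -, hl, hl'⟩ := left
  have hu := norm_eq_one_of_mul_conj hu
  rw [← map_mul, sub_conj_eq_iff] at hr hl
  rw [norm_sub_lt_iff cp.α_ne_zero cp.sq_add_sq hz hu hr] at hr'
  rw [norm_sub_lt_iff ((map_ne_zero _).2 cm.α_ne_zero)
    (by rw [RCLike.norm_conj, norm_neg, cm.sq_add_sq]) (by rwa [RCLike.norm_conj]) hu hl] at hl'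
  simp only [neg_mul, Complex.neg_im, Complex.neg_re, Complex.conj_re, Complex.conj_im, neg_inj,
    mul_neg, Left.neg_pos_iff] at hl hl'
  exact ⟨z, u, rfl, hz, hu, hr, hl, hr', hl'⟩

/-! ### From a matching pair to an eigenvector -/

/-- The sequence on `ℤ` with ratio `lam` to the right of `0` and `kap` to the left. -/
def twoSidedGeom (lam kap : ℂ) (x : ℤ) : ℂ :=
  if 0 ≤ x then lam ^ x.toNat else kap ^ (-x).toNat

theorem twoSidedGeom_add_one {lam kap : ℂ} {x : ℤ} (hx : 0 ≤ x) :
    twoSidedGeom lam kap (x + 1) = lam * twoSidedGeom lam kap x := by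
  lift x to ℕ using hx
  rw [twoSidedGeom, twoSidedGeom, if_pos (by lia), if_pos (by lia), ← pow_succ']
  rfl

theorem twoSidedGeom_neg (lam kap : ℂ) (n : ℕ) :
    twoSidedGeom lam kap (-(n : ℤ)) = kap ^ n := by
  rcases Nat.eq_zero_or_pos n with rfl | hn
  · simp [twoSidedGeom]
  · rw [twoSidedGeom, if_neg (by lia), neg_neg, Int.toNat_natCast]

theorem twoSidedGeom_of_neg {lam kap : ℂ} {x : ℤ} (hx : x < 0) :
    twoSidedGeom lam kap x = kap * twoSidedGeom lam kap (x + 1) := by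
  obtain ⟨n, hn⟩ := Int.eq_ofNat_of_zero_le (show 0 ≤ -(x + 1) by lia)
  obtain rfl : x = -((n + 1 : ℕ) : ℤ) := by push_cast; lia
  rw [show -((n + 1 : ℕ) : ℤ) + 1 = -(n : ℤ) by push_cast; ring, twoSidedGeom_neg,
    twoSidedGeom_neg, pow_succ']

theorem summable_twoSidedGeom {lam kap : ℂ} (hl : ‖lam‖ < 1) (hk : ‖kap‖ < 1) :
    Summable fun x : ℤ => ‖twoSidedGeom lam kap x‖ ^ 2 := by
  have geom : ∀ w : ℂ, ‖w‖ < 1 → Summable fun n : ℕ => ‖w ^ n‖ ^ 2 := fun w hw => by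
    refine (summable_geometric_of_lt_one (sq_nonneg ‖w‖) (by nlinarith [norm_nonneg w])).congr
      fun n => ?_
    rw [norm_pow, ← pow_mul, ← pow_mul, mul_comm]
  refine Summable.of_nat_of_neg ?_ ?_
  · simpa [twoSidedGeom] using geom lam hl
  · simpa only [twoSidedGeom_neg] using geom kap hk

theorem IsMatching.mem_pointSpectrum {cm cp : Coin} {Δ : ℝ} (hp : cp.Δ = Δ) (hm : cm.Δ = Δ)
    {z u : ℂ} (h : IsMatching cm.β cp.β z u) :
    Complex.exp (Complex.I * Δ) * z ∈ pointSpectrum (evolution (twoPhaseOneDefect cm cp cp)) := by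
  obtain ⟨hz, hu, hr, hl, hr', hl'⟩ := h
  have hzz := mul_conj_eq_one hz
  have huu := mul_conj_eq_one hu
  have hmα : conj cm.α ≠ 0 := (map_ne_zero _).2 cm.α_ne_zero
  have hlam := (norm_sub_lt_iff cp.α_ne_zero cp.sq_add_sq hz hu hr).2 hr'
  have hkap := (norm_sub_lt_iff (α := conj cm.α) (β := -cm.β) (z := conj z) hmα
    (by rw [RCLike.norm_conj, norm_neg, cm.sq_add_sq]) (by rwa [RCLike.norm_conj]) hu
    (by rw [neg_mul, Complex.neg_im, Complex.conj_im, hl])).2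
    (by rwa [neg_mul, Complex.neg_re, Complex.conj_re, mul_neg, Left.neg_pos_iff])
  rw [← div_lt_one (norm_pos_iff.2 cp.α_ne_zero), ← norm_div] at hlam
  rw [← div_lt_one (norm_pos_iff.2 hmα), ← norm_div, neg_mul, sub_neg_eq_add] at hkap
  set g := twoSidedGeom ((z - cp.β * u) / cp.α) ((conj z + cm.β * u) / conj cm.α) with hg
  have hsum : Summable fun x : ℤ => ‖g x‖ ^ 2 := summable_twoSidedGeom hlam hkap
  rw [← sub_conj_eq_iff, map_mul] at hr hl
  have step : ∀ x, (twoPhaseOneDefect cm cp cp x).α * g (x + 1) =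
      (z - (twoPhaseOneDefect cm cp cp x).β * u) * g x := fun x => by
    rcases lt_or_ge x 0 with hx | hx
    · have hk : (z - cm.β * u) * ((conj z + cm.β * u) / conj cm.α) = cm.α := by
        rw [← mul_div_assoc, div_eq_iff hmα]
        linear_combination hzz - cm.mul_conj_add - cm.β * u * hl - cm.β * conj cm.β * huu
      rw [twoPhaseOneDefect_of_neg hx, hg, twoSidedGeom_of_neg hx, ← hg, ← mul_assoc, hk]
    · rw [twoPhaseOneDefect_of_nonneg hx, hg, twoSidedGeom_add_one hx, ← hg, ← mul_assoc,
        mul_div_cancel₀ _ cp.α_ne_zero]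
  have him : ∀ x, conj z - conj (twoPhaseOneDefect cm cp cp x).β * conj u =
      z - (twoPhaseOneDefect cm cp cp x).β * u := fun x => by
    rcases lt_or_ge x 0 with hx | hx
    · rwa [twoPhaseOneDefect_of_neg hx]
    · rwa [twoPhaseOneDefect_of_nonneg hx]
  -- The index shift makes the transfer vector at `x` equal to `g x • (1, u)`.
  let Ψ : State := ⟨fun x => !₂[g (x + 1), u * g x], memℓp_of_summable (by
    simpa [EuclideanSpace.norm_sq_eq, Fin.sum_univ_two, hu] using
      ((Equiv.addRight (1 : ℤ)).summable_iff.2 hsum).add hsum)⟩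
  have Ψ0 : ∀ x, Ψ x 0 = g (x + 1) := fun _ => rfl
  have Ψ1 : ∀ x, Ψ x 1 = u * g x := fun _ => rfl
  have hΔ := twoPhaseOneDefect_Δ hp hm
  refine ⟨Ψ, fun h0 => ?_, lp.ext (funext fun x => PiLp.ext fun i => ?_)⟩
  · have h1 : Ψ (-1) 0 = 0 := by rw [h0]; rfl
    rw [Ψ0] at h1
    simp [hg, twoSidedGeom] at h1
  · fin_cases i
    · change evolution _ Ψ x 0 = _ * Ψ x 0
      rw [evolution_apply_zero, hΔ, Ψ0, Ψ0, Ψ1]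
      linear_combination Complex.exp (Complex.I * Δ) * step (x + 1)
    · change evolution _ Ψ x 1 = _ * Ψ x 1
      rw [evolution_apply_one, hΔ, Ψ0, Ψ1, Ψ1, mul_assoc]
      congr 1
      have hs := step (x - 1)
      have hi := him (x - 1)
      have hc := (twoPhaseOneDefect cm cp cp (x - 1)).mul_conj_add
      have hα := (twoPhaseOneDefect cm cp cp (x - 1)).α_ne_zero
      rw [sub_add_cancel] at hs ⊢
      generalize twoPhaseOneDefect cm cp cp (x - 1) = d at *
      refine mul_left_cancel₀ hα ?_
      linear_combination (-conj d.β - z * u) * hs + g (x - 1) * (u * hc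
        + z * u * hi - u * hzz + z * conj d.β * huu)

/-! ### Solving the matching conditions -/

theorem mul_conj_eq_of_norm_one {βm βp u : ℂ} (hu : ‖u‖ = 1) :
    βm * conj βp = (βm * u) * conj (βp * u) := by
  rw [map_mul]
  linear_combination -βm * conj βp * mul_conj_eq_one hu

theorem norm_sq_of_norm_one {β u : ℂ} (hu : ‖u‖ = 1) :
    ‖β‖ ^ 2 = (β * u).re ^ 2 + (β * u).im ^ 2 := by
  rw [sq_re_add_sq_im, norm_mul, hu, mul_one]

theorem product_eq_of_im_eq {βm βp u : ℂ} (hu : ‖u‖ = 1) (h : (βm * u).im = (βp * u).im) :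
    ((βm * conj βp).re - ‖βp‖ ^ 2) * ((βm * conj βp).re - ‖βm‖ ^ 2) =
      -((βp * u).re * (βm * u).re) * ((βp * u).re - (βm * u).re) ^ 2 := by
  rw [mul_conj_eq_of_norm_one hu, norm_sq_of_norm_one (β := βp) hu, norm_sq_of_norm_one (β := βm) hu, h,
    Complex.mul_re, Complex.conj_re, Complex.conj_im, h]
  ring

theorem IsMatching.re_mul_re_neg {βm βp z u : ℂ} (h : IsMatching βm βp z u) :
    (βp * u).re * (βm * u).re < 0 := by
  have h1 := mul_neg_of_pos_of_neg h.re_right h.re_left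
  by_contra! h2
  nlinarith [mul_nonneg (sq_nonneg z.re) h2]

theorem IsMatching.product_pos {βm βp z u : ℂ} (h : IsMatching βm βp z u) :
    0 < ((βm * conj βp).re - ‖βp‖ ^ 2) * ((βm * conj βp).re - ‖βm‖ ^ 2) := by
  rw [product_eq_of_im_eq h.norm_u (h.im_left.trans h.im_right.symm)]
  have h1 := h.re_mul_re_neg
  have h2 : (βp * u).re - (βm * u).re ≠ 0 := fun h0 => by
    rw [sub_eq_zero.1 h0] at h1
    nlinarith [sq_nonneg (βm * u).re]
  have : 0 < -((βp * u).re * (βm * u).re) := by linarith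
  positivity

theorem exists_isMatching_of_product_pos {βm βp : ℂ} (hβ : ‖βp‖ ≤ 1)
    (h : 0 < ((βm * conj βp).re - ‖βp‖ ^ 2) * ((βm * conj βp).re - ‖βm‖ ^ 2)) :
    ∃ z u, IsMatching βm βp z u := by
  have hne : βp - βm ≠ 0 := fun h0 => by
    rw [sub_eq_zero.1 h0, Complex.mul_conj'] at h
    norm_cast at h
    simp at h
  have hn : (‖βp - βm‖ : ℂ) ≠ 0 := by simpa using hne
  -- This rotation makes `(βp - βm) * u` real and positive, so the imaginary parts agree.
  obtain ⟨u, hu⟩ : ∃ u, u = conj (βp - βm) / ‖βp - βm‖ := ⟨_, rfl⟩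
  have hu1 : ‖u‖ = 1 := by
    rw [hu, norm_div, RCLike.norm_conj, Complex.norm_real, norm_norm,
      div_self (norm_ne_zero_iff.2 hne)]
  have hd : βp * u - βm * u = ‖βp - βm‖ := by
    rw [← sub_mul, hu, ← mul_div_assoc, Complex.mul_conj', sq, mul_div_cancel_right₀ _ hn]
  have him : (βm * u).im = (βp * u).im := by
    have := congrArg Complex.im hd
    rw [Complex.sub_im, Complex.ofReal_im] at this
    linarith
  have hre : 0 < (βp * u).re - (βm * u).re := by
    have := congrArg Complex.re hd
    rw [Complex.sub_re, Complex.ofReal_re] at this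
    rw [this]
    exact norm_pos_iff.2 hne
  rw [product_eq_of_im_eq hu1 him] at h
  have hneg : (βp * u).re * (βm * u).re < 0 := by
    have := (pos_iff_pos_of_mul_pos h).2 (by positivity)
    linarith
  have hp : 0 < (βp * u).re := by
    by_contra! h0
    nlinarith
  have hm : (βm * u).re < 0 := by
    by_contra! h0
    nlinarith
  have hs : (βp * u).re ^ 2 + (βp * u).im ^ 2 ≤ 1 := by
    rw [← norm_sq_of_norm_one hu1]
    exact pow_le_one₀ (norm_nonneg _) hβ
  have hpos : 0 < 1 - (βp * u).im ^ 2 := by nlinarith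
  have hc := Real.sqrt_pos.2 hpos
  -- `|z| = 1` and the prescribed `Im z` leave two roots; the sign of `Re (βp * u)` selects the
  -- positive one.
  refine ⟨⟨√(1 - (βp * u).im ^ 2), (βp * u).im⟩, u, ?_, hu1, rfl, him, mul_pos hc hp,
    mul_neg_of_pos_of_neg hc hm⟩
  rw [← sq_eq_sq₀ (norm_nonneg _) zero_le_one, ← sq_re_add_sq_im, Real.sq_sqrt hpos.le]
  ring

/-- With `c = Re z`, `p = Re (βp u)`, `m = Re (βm u)`, one has `|αp|² = c² - p²` and `|αm|² = c² -
m²`; the radicand is `(mp - c²)² - (c² - p²)(c² - m²)`. -/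
theorem IsMatching.radicand_eq {αm αp βm βp z u : ℂ} (h : IsMatching βm βp z u)
    (hm : ‖αm‖ ^ 2 + ‖βm‖ ^ 2 = 1) (hp : ‖αp‖ ^ 2 + ‖βp‖ ^ 2 = 1) :
    ((βm * conj βp).re + ‖αp‖ * ‖αm‖ - 1) * ((βm * conj βp).re - ‖αp‖ * ‖αm‖ - 1) =
      (z.re * ((βp * u).re - (βm * u).re)) ^ 2 := by
  have h1 := sq_re_add_sq_im z
  rw [h.norm_z] at h1
  rw [norm_sq_of_norm_one (β := βm) h.norm_u, h.im_left] at hm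
  rw [norm_sq_of_norm_one (β := βp) h.norm_u, h.im_right] at hp
  rw [mul_conj_eq_of_norm_one h.norm_u, Complex.mul_re, Complex.conj_re, Complex.conj_im, h.im_left,
    h.im_right]
  have hm' : ‖αm‖ ^ 2 = z.re ^ 2 - (βm * u).re ^ 2 := by linarith
  have hp' : ‖αp‖ ^ 2 = z.re ^ 2 - (βp * u).re ^ 2 := by linarith
  generalize (βm * u).re = m at *
  generalize (βp * u).re = p at *
  have hs : z.im ^ 2 = 1 - z.re ^ 2 := by linarith
  calc _ = (m * p + z.im ^ 2 - 1) ^ 2 - ‖αp‖ ^ 2 * ‖αm‖ ^ 2 := by ring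
    _ = _ := by rw [hs, hm', hp']; ring

theorem IsMatching.mul_norm_eq {αm αp βm βp z u : ℂ} (h : IsMatching βm βp z u)
    (hm : ‖αm‖ ^ 2 + ‖βm‖ ^ 2 = 1) (hp : ‖αp‖ ^ 2 + ‖βp‖ ^ 2 = 1) (hpos : 0 < z.re) :
    z * ‖βp - βm‖ =
      (√(((βm * conj βp).re + ‖αp‖ * ‖αm‖ - 1) * ((βm * conj βp).re - ‖αp‖ * ‖αm‖ - 1)) : ℂ) +
        Complex.I * (βm * conj βp).im := by
  have hp0 : 0 < (βp * u).re := (pos_iff_pos_of_mul_pos h.re_right).1 hpos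
  have hm0 : (βm * u).re < 0 := by
    have := h.re_left
    by_contra! h0
    nlinarith
  have hd : 0 < (βp * u).re - (βm * u).re := by linarith
  -- The points `βp u` and `βm u` lie on one horizontal line.
  have hN : ‖βp - βm‖ = (βp * u).re - (βm * u).re := by
    rw [← sq_eq_sq₀ (norm_nonneg _) hd.le, norm_sq_of_norm_one h.norm_u, sub_mul, Complex.sub_re,
      Complex.sub_im, h.im_left, h.im_right]
    ring
  rw [h.radicand_eq hm hp, Real.sqrt_sq (mul_pos hpos hd).le, hN, mul_conj_eq_of_norm_one h.norm_u]
  apply Complex.ext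
  · rw [Complex.re_mul_ofReal, Complex.add_re, Complex.I_mul_re, Complex.ofReal_im,
      Complex.ofReal_re, neg_zero, add_zero]
  · rw [Complex.im_mul_ofReal, Complex.add_im, Complex.I_mul_im, Complex.ofReal_im,
      Complex.ofReal_re, Complex.mul_im, Complex.conj_re, Complex.conj_im, h.im_left, h.im_right]
    ring

end QuantumWalk

theorem mainTheorem5 (cm co cp : QuantumWalk.Coin) (Δ : ℝ)
    (ho : co = cp) (hp : cp.Δ = Δ) (hm : cm.Δ = Δ) (U : QuantumWalk.State ≃ₗᵢ[ℂ] QuantumWalk.State)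
    (hU : U = QuantumWalk.evolution (QuantumWalk.twoPhaseOneDefect cm co cp))
    (R J P : ℝ) (hR : R = (cm.β * conj cp.β).re) (hJ : J = (cm.β * conj cp.β).im)
    (hP : P = (R + ‖cp.α‖ * ‖cm.α‖ - 1) * (R - ‖cp.α‖ * ‖cm.α‖ - 1)) :
    ((QuantumWalk.pointSpectrum U).Nonempty ↔
        0 < (R - ‖cp.β‖ ^ 2) * (R - ‖cm.β‖ ^ 2)) ∧
      ((QuantumWalk.pointSpectrum U).Nonempty →
        0 ≤ P ∧ cp.β ≠ cm.β ∧
          ∃ e₁ : ℂ,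
            e₁ = Complex.exp (Complex.I * Δ) * ((Real.sqrt P : ℂ) + Complex.I * J) /
                (‖cp.β - cm.β‖ : ℂ) ∧
              QuantumWalk.pointSpectrum U = {e₁, -e₁}) := by
  subst hU ho hP hR hJ
  constructor
  · constructor
    · rintro ⟨μ, hμ⟩
      obtain ⟨z, u, -, h⟩ := QuantumWalk.exists_isMatching hp hm hμ
      exact h.product_pos
    · intro h
      obtain ⟨z, u, h⟩ := QuantumWalk.exists_isMatching_of_product_pos
        (by nlinarith [co.sq_add_sq, sq_nonneg ‖co.α‖]) h
      exact ⟨_, h.mem_pointSpectrum hp hm⟩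
  · rintro ⟨μ, hμ⟩
    obtain ⟨z, u, -, h⟩ := QuantumWalk.exists_isMatching hp hm hμ
    have hne : co.β ≠ cm.β := fun h0 => by
      have := h.re_mul_re_neg
      rw [h0] at this
      nlinarith [sq_nonneg (cm.β * u).re]
    have hN : (‖co.β - cm.β‖ : ℂ) ≠ 0 := by simpa [sub_eq_zero] using hne
    refine ⟨by rw [h.radicand_eq cm.sq_add_sq co.sq_add_sq]; positivity, hne, _, rfl, ?_⟩
    -- The right side does not involve `u`: all matching pairs with `Re z > 0` give one eigenvalue,
    -- and `IsMatching.neg` handles `Re z < 0`.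
    have key : ∀ z u, QuantumWalk.IsMatching cm.β co.β z u → 0 < z.re →
        Complex.exp (Complex.I * Δ) * z = Complex.exp (Complex.I * Δ) *
          ((√(((cm.β * conj co.β).re + ‖co.α‖ * ‖cm.α‖ - 1) *
            ((cm.β * conj co.β).re - ‖co.α‖ * ‖cm.α‖ - 1)) : ℂ) +
            Complex.I * (cm.β * conj co.β).im) / (‖co.β - cm.β‖ : ℂ) := fun z u h hpos => by
      rw [← h.mul_norm_eq cm.sq_add_sq co.sq_add_sq hpos, ← mul_assoc, mul_div_cancel_right₀ _ hN]
    have hz : ∀ {z u}, QuantumWalk.IsMatching cm.β co.β z u → z.re < 0 ∨ 0 < z.re := fun h =>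
      lt_or_gt_of_ne fun h0 => by simpa [h0] using h.re_right
    refine Set.Subset.antisymm (fun ν hν => ?_) ?_
    · obtain ⟨w, v, rfl, hw⟩ := QuantumWalk.exists_isMatching hp hm hν
      rcases hz hw with h1 | h1
      · right
        rw [Set.mem_singleton_iff, ← key _ _ hw.neg (by simpa using h1), mul_neg, neg_neg]
      · left
        exact key _ _ hw h1
    · obtain ⟨w, v, hw, h1⟩ : ∃ w v, QuantumWalk.IsMatching cm.β co.β w v ∧ 0 < w.re := by
        rcases hz h with h1 | h1
        · exact ⟨_, _, h.neg, by simpa using h1⟩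
        · exact ⟨_, _, h, h1⟩
      rw [← key _ _ hw h1, ← mul_neg]
      rintro ν (rfl | rfl)
      · exact hw.mem_pointSpectrum hp hm
      · exact hw.neg.mem_pointSpectrum hp hm
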